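/- Let $n \ge 2$ be an integer and let $A$ be an alphabet with $n$ letters. A right ideal of the free monoid $A^*$ is a set $R\subseteq A^*$ with $RA^*\subseteq R$; it is essential if it meets every nonempty right ideal of $A^*$, and finitely generated if $R=\Gamma A^*$ for some finite $\Gamma$. A right-ideal isomorphism is a bijection $\varphi:R_1\to R_2$ between right ideals with $\varphi(ux)=\varphi(u)x$ for all $u\in R_1$, $x\in A^*$; it is maximal if no right-ideal isomorphism of $A^*$ strictly extends it. Every isomorphism $\varphi$ between essential right ideals has a unique maximum extension $\max\varphi$. The Thompson--Higman group $G_{n,1}$ is the set of all maximal isomorphisms between finitely generated essential right ideals of $A^*$, with product $\varphi\cdot\psi=\max(\varphi\circ\psi)$ ($\psi$ applied first), and $V=G_{2,1}$ is the Thompson group. The Cuntz (or Cuntz--Dixmier) algebra $\mathcal{O}_n$ is the universal unital C$^*$-algebra generated by $s_1,\dots,s_n$ subject to $s_i^*s_i=1$, $s_i^*s_j=0$ for $i\neq j$, and $\sum_{i=1}^n s_is_i^*=1$. Then $V$ is isomorphic to a subgroup of the group of invertible elements of $\mathcal{O}_2$. More generally, for every $n\ge 2$, the group $G_{n,1}$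 is isomorphic to a subgroup of the group of invertible elements of $\mathcal{O}_n$. -/

import Mathlib

open scoped ENNReal CStarAlgebra

/-! ## Words, right ideals and right-ideal isomorphisms

Words over the alphabet `A` are lists; the free monoid `A^*` is `List A` with concatenation `++`.
-/

section ThompsonHigman

variable {A : Type*}

/-- `R ⊆ A^*` is a right ideal: `R · A^* ⊆ R`. -/
def IsRightIdeal (R : Set (List A)) : Prop :=
  ∀ u ∈ R, ∀ x : List A, u ++ x ∈ R

/-- `R ⊆ A^*` is an essential right ideal: a right ideal that meets every (nonempty) right
ideal of `A^*`. -/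
def IsEssentialRightIdeal (R : Set (List A)) : Prop :=
  IsRightIdeal R ∧ ∀ J : Set (List A), IsRightIdeal J → J.Nonempty → (R ∩ J).Nonempty

/-- The right ideal `R` is finitely generated: `R = Γ · A^*` for some finite `Γ`. -/
def IsFGRightIdeal (R : Set (List A)) : Prop :=
  ∃ Γ : Set (List A), Γ.Finite ∧ R = {w | ∃ γ ∈ Γ, ∃ x : List A, w = γ ++ x}

/-- The domain of a partial bijection of `A^*`. -/
def pdom (φ : List A ≃. List A) : Set (List A) := {u | ∃ v, v ∈ φ u}

/-- The image of a partial bijection of `A^*`. -/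
def pim (φ : List A ≃. List A) : Set (List A) := {v | ∃ u, v ∈ φ u}

/-- A right-ideal isomorphism of `A^*`: a bijection `φ : R₁ → R₂` between right ideals of `A^*`
with `φ (u x) = φ (u) x` for all `u ∈ R₁` and `x ∈ A^*`. -/
structure IsRightIdealIso (φ : List A ≃. List A) : Prop where
  dom : IsRightIdeal (pdom φ)
  im : IsRightIdeal (pim φ)
  map_append : ∀ u v : List A, v ∈ φ u → ∀ x : List A, v ++ x ∈ φ (u ++ x)

/-- A right-ideal isomorphism between finitely generated essential right ideals. -/
structure IsFGEssentialIso (φ : List A ≃. List A) : Prop where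
  iso : IsRightIdealIso φ
  essential_dom : IsEssentialRightIdeal (pdom φ)
  essential_im : IsEssentialRightIdeal (pim φ)
  fg_dom : IsFGRightIdeal (pdom φ)
  fg_im : IsFGRightIdeal (pim φ)

/-- A right-ideal isomorphism is maximal if no right-ideal isomorphism extends it strictly
(`≤` on partial bijections is extension). -/
def IsMaximalIso (φ : List A ≃. List A) : Prop :=
  ∀ ψ : List A ≃. List A, IsRightIdealIso ψ → φ ≤ ψ → ψ = φ

/-- `ψ` is the maximum extension of `φ`: a right-ideal isomorphism that extends `φ` and every
right-ideal isomorphism extending `φ`. -/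
def IsMaxExtension (φ ψ : List A ≃. List A) : Prop :=
  IsGreatest {χ | IsRightIdealIso χ ∧ φ ≤ χ} ψ

open Classical in
/-- The maximum extension `max φ` of `φ`. It exists when `φ` is an isomorphism between essential
right ideals (see `isMaxExtension_maxExt`); otherwise the value is irrelevant. -/
noncomputable def maxExt (φ : List A ≃. List A) : List A ≃. List A :=
  if h : ∃ ψ, IsMaxExtension φ ψ then h.choose else ⊥

theorem IsMaxExtension.maxExt_eq {φ ψ : List A ≃. List A} (h : IsMaxExtension φ ψ) :
    maxExt φ = ψ := by
  have h' : ∃ ψ, IsMaxExtension φ ψ := ⟨ψ, h⟩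
  unfold maxExt
  rw [dif_pos h']
  exact h'.choose_spec.unique h

theorem pdom_symm (φ : List A ≃. List A) : pdom φ.symm = pim φ := by
  ext v; simp only [pdom, pim, Set.mem_ofPred_eq, PEquiv.mem_iff_mem]

theorem pim_symm (φ : List A ≃. List A) : pim φ.symm = pdom φ := by
  ext v; simp only [pdom, pim, Set.mem_ofPred_eq, PEquiv.mem_iff_mem]

theorem IsRightIdealIso.symm {φ : List A ≃. List A} (h : IsRightIdealIso φ) :
    IsRightIdealIso φ.symm where
  dom := by rw [pdom_symm]; exact h.im
  im := by rw [pim_symm]; exact h.dom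
  map_append u v hv x := by
    rw [PEquiv.mem_iff_mem] at hv ⊢
    exact h.map_append _ _ hv x

theorem IsRightIdealIso.of_map_append {φ : List A ≃. List A}
    (h : ∀ u v : List A, v ∈ φ u → ∀ x : List A, v ++ x ∈ φ (u ++ x)) : IsRightIdealIso φ where
  dom := fun u ⟨v, hv⟩ x => ⟨v ++ x, h u v hv x⟩
  im := fun v ⟨u, hu⟩ x => ⟨u ++ x, h u v hu x⟩
  map_append := h

theorem IsFGEssentialIso.symm {φ : List A ≃. List A} (h : IsFGEssentialIso φ) :
    IsFGEssentialIso φ.symm where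
  iso := h.iso.symm
  essential_dom := by rw [pdom_symm]; exact h.essential_im
  essential_im := by rw [pim_symm]; exact h.essential_dom
  fg_dom := by rw [pdom_symm]; exact h.fg_im
  fg_im := by rw [pim_symm]; exact h.fg_dom

theorem PEquiv.symm_le_symm_of_le {φ ψ : List A ≃. List A} (h : φ ≤ ψ) : φ.symm ≤ ψ.symm := by
  intro a b hb
  rw [PEquiv.mem_iff_mem] at hb ⊢
  exact h _ _ hb

theorem IsMaximalIso.symm {φ : List A ≃. List A} (h : IsMaximalIso φ) : IsMaximalIso φ.symm := by
  intro ψ hψ hle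
  have := h ψ.symm hψ.symm (by simpa using PEquiv.symm_le_symm_of_le hle)
  rw [← this, PEquiv.symm_symm]

theorem essential_iff {R : Set (List A)} (hR : IsRightIdeal R) :
    IsEssentialRightIdeal R ↔ ∀ u : List A, ∃ x : List A, u ++ x ∈ R := by
  constructor
  · rintro ⟨-, h⟩ u
    obtain ⟨w, hw, x, rfl⟩ := h {w | ∃ x, w = u ++ x}
      (by rintro _ ⟨x, rfl⟩ y; exact ⟨x ++ y, by simp⟩) ⟨u, [], by simp⟩
    exact ⟨x, hw⟩
  · intro h
    refine ⟨hR, fun J hJ ⟨u, hu⟩ => ?_⟩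
    obtain ⟨x, hx⟩ := h u
    exact ⟨u ++ x, hx, hJ u hu x⟩

/-- An isomorphism between essential right ideals has a maximum extension, namely the union of
all its extensions. -/
theorem exists_isMaxExtension {φ : List A ≃. List A} (hφ : IsRightIdealIso φ)
    (hd : IsEssentialRightIdeal (pdom φ)) (hi : IsEssentialRightIdeal (pim φ)) :
    ∃ ψ, IsMaxExtension φ ψ := by
  classical
  have key : ∀ φ : List A ≃. List A, IsEssentialRightIdeal (pdom φ) →
      ∀ ψ₁ ψ₂ : List A ≃. List A, IsRightIdealIso ψ₁ → IsRightIdealIso ψ₂ → φ ≤ ψ₁ → φ ≤ ψ₂ →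
      ∀ u v₁ v₂, v₁ ∈ ψ₁ u → v₂ ∈ ψ₂ u → v₁ = v₂ := by
    intro φ hd ψ₁ ψ₂ h₁ h₂ l₁ l₂ u v₁ v₂ m₁ m₂
    obtain ⟨x, w, hw⟩ := (essential_iff hd.1).1 hd u
    have e₁ := Option.mem_unique (l₁ _ _ hw) (h₁.map_append _ _ m₁ x)
    have e₂ := Option.mem_unique (l₂ _ _ hw) (h₂.map_append _ _ m₂ x)
    exact List.append_cancel_right (e₁.symm.trans e₂)
  let r : List A → List A → Prop := fun u v =>
    ∃ ψ : List A ≃. List A, IsRightIdealIso ψ ∧ φ ≤ ψ ∧ v ∈ ψ u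
  have r_right : ∀ u v₁ v₂, r u v₁ → r u v₂ → v₁ = v₂ := by
    rintro u v₁ v₂ ⟨ψ₁, h₁, l₁, m₁⟩ ⟨ψ₂, h₂, l₂, m₂⟩
    exact key φ hd ψ₁ ψ₂ h₁ h₂ l₁ l₂ u v₁ v₂ m₁ m₂
  have r_left : ∀ u₁ u₂ v, r u₁ v → r u₂ v → u₁ = u₂ := by
    rintro u₁ u₂ v ⟨ψ₁, h₁, l₁, m₁⟩ ⟨ψ₂, h₂, l₂, m₂⟩
    exact key φ.symm (by rwa [pdom_symm]) ψ₁.symm ψ₂.symm h₁.symm h₂.symm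
      (PEquiv.symm_le_symm_of_le l₁) (PEquiv.symm_le_symm_of_le l₂) v u₁ u₂
      ((PEquiv.mem_iff_mem _).2 m₁) ((PEquiv.mem_iff_mem _).2 m₂)
  let f : List A → Option (List A) := fun u => if h : ∃ v, r u v then some h.choose else none
  let g : List A → Option (List A) := fun v => if h : ∃ u, r u v then some h.choose else none
  have hf : ∀ u v, f u = some v ↔ r u v := by
    intro u v
    by_cases h : ∃ v, r u v
    · simp only [f, dif_pos h, Option.some.injEq]
      exact ⟨fun e => e ▸ h.choose_spec, fun m => r_right _ _ _ h.choose_spec m⟩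
    · simp only [f, dif_neg h, reduceCtorEq, false_iff]
      exact fun m => h ⟨v, m⟩
  have hg : ∀ v u, g v = some u ↔ r u v := by
    intro v u
    by_cases h : ∃ u, r u v
    · simp only [g, dif_pos h, Option.some.injEq]
      exact ⟨fun e => e ▸ h.choose_spec, fun m => r_left _ _ _ h.choose_spec m⟩
    · simp only [g, dif_neg h, reduceCtorEq, false_iff]
      exact fun m => h ⟨u, m⟩
  let Ψ : List A ≃. List A := ⟨f, g, fun u v => by rw [hf, hg]⟩
  have mem : ∀ u v, v ∈ Ψ u ↔ r u v := hf
  refine ⟨Ψ, ⟨IsRightIdealIso.of_map_append ?_, ?_⟩, ?_⟩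
  · intro u v hv x
    obtain ⟨ψ, h, l, m⟩ := (mem _ _).1 hv
    exact (mem _ _).2 ⟨ψ, h, l, h.map_append _ _ m x⟩
  · intro u v hv
    exact (mem _ _).2 ⟨φ, hφ, le_rfl, hv⟩
  · rintro ψ ⟨h, l⟩ u v hv
    exact (mem _ _).2 ⟨ψ, h, l, hv⟩

theorem isMaxExtension_maxExt {φ : List A ≃. List A} (hφ : IsFGEssentialIso φ) :
    IsMaxExtension φ (maxExt φ) := by
  obtain ⟨ψ, hψ⟩ := exists_isMaxExtension hφ.iso hφ.essential_dom hφ.essential_im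
  rwa [hψ.maxExt_eq]

/-- A finitely generated essential right ideal contains all sufficiently long words. -/
theorem exists_length_bound {R : Set (List A)} (hR : IsEssentialRightIdeal R)
    (hfg : IsFGRightIdeal R) : ∃ N : ℕ, ∀ w : List A, N ≤ w.length → w ∈ R := by
  obtain ⟨Γ, hΓ, rfl⟩ := hfg
  obtain ⟨N, hN⟩ := (hΓ.image List.length).bddAbove
  refine ⟨N, fun w hw => ?_⟩
  obtain ⟨x, γ, hγ, z, hz⟩ := (essential_iff hR.1).1 hR w
  have hle : γ.length ≤ w.length := (hN ⟨γ, hγ, rfl⟩).trans hw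
  obtain ⟨t, ht⟩ := List.prefix_of_prefix_length_le ⟨z, hz.symm⟩ (List.prefix_append w x) hle
  exact ⟨γ, hγ, t, ht.symm⟩

theorem isFG_of_length_bound [Finite A] {R : Set (List A)} (hR : IsRightIdeal R)
    (h : ∃ N : ℕ, ∀ w : List A, N ≤ w.length → w ∈ R) : IsFGRightIdeal R := by
  obtain ⟨N, hN⟩ := h
  refine ⟨{w | w ∈ R ∧ w.length ≤ N}, (List.finite_length_le A N).subset fun w hw => hw.2, ?_⟩
  ext w
  constructor
  · intro hw
    rcases le_total w.length N with hl | hl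
    · exact ⟨w, ⟨hw, hl⟩, [], by simp⟩
    · refine ⟨w.take N, ⟨hN _ ?_, ?_⟩, w.drop N, by simp⟩ <;> simp [hl]
  · rintro ⟨γ, ⟨hγ, -⟩, x, rfl⟩
    exact hR γ hγ x

/-- Extensions of isomorphisms between finitely generated essential right ideals are again of
this kind. -/
theorem IsFGEssentialIso.of_le [Finite A] {φ ψ : List A ≃. List A} (hφ : IsFGEssentialIso φ)
    (hψ : IsRightIdealIso ψ) (hle : φ ≤ ψ) : IsFGEssentialIso ψ := by
  have sd : pdom φ ⊆ pdom ψ := fun u ⟨v, hv⟩ => ⟨v, hle _ _ hv⟩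
  have si : pim φ ⊆ pim ψ := fun u ⟨v, hv⟩ => ⟨v, hle _ _ hv⟩
  refine ⟨hψ, ⟨hψ.dom, fun J hJ hne => ?_⟩, ⟨hψ.im, fun J hJ hne => ?_⟩,
    isFG_of_length_bound hψ.dom ?_, isFG_of_length_bound hψ.im ?_⟩
  · exact (hφ.essential_dom.2 J hJ hne).mono (Set.inter_subset_inter_left _ sd)
  · exact (hφ.essential_im.2 J hJ hne).mono (Set.inter_subset_inter_left _ si)
  · obtain ⟨N, hN⟩ := exists_length_bound hφ.essential_dom hφ.fg_dom
    exact ⟨N, fun w hw => sd (hN w hw)⟩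
  · obtain ⟨N, hN⟩ := exists_length_bound hφ.essential_im hφ.fg_im
    exact ⟨N, fun w hw => si (hN w hw)⟩

theorem trans_dom_aux [Finite A] {φ ψ : List A ≃. List A} (hφ : IsFGEssentialIso φ)
    (hψ : IsFGEssentialIso ψ) (hiso : IsRightIdealIso (φ.trans ψ)) :
    IsEssentialRightIdeal (pdom (φ.trans ψ)) ∧ IsFGRightIdeal (pdom (φ.trans ψ)) := by
  constructor
  · rw [essential_iff hiso.dom]
    intro u
    obtain ⟨x, v, hv⟩ := (essential_iff hφ.iso.dom).1 hφ.essential_dom u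
    obtain ⟨y, w, hw⟩ := (essential_iff hψ.iso.dom).1 hψ.essential_dom v
    refine ⟨x ++ y, w, (PEquiv.mem_trans _ _ _ _).2 ⟨v ++ y, ?_, hw⟩⟩
    rw [← List.append_assoc]
    exact hφ.iso.map_append _ _ hv y
  · refine isFG_of_length_bound hiso.dom ?_
    obtain ⟨N₁, h₁⟩ := exists_length_bound hφ.essential_dom hφ.fg_dom
    obtain ⟨N₂, h₂⟩ := exists_length_bound hψ.essential_dom hψ.fg_dom
    refine ⟨N₁ + N₂, fun w hw => ?_⟩
    obtain ⟨v, hv⟩ := h₁ (w.take N₁) (by simp; omega)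
    obtain ⟨z, hz⟩ := h₂ (v ++ w.drop N₁) (by simp; omega)
    refine ⟨z, (PEquiv.mem_trans _ _ _ _).2 ⟨v ++ w.drop N₁, ?_, hz⟩⟩
    have := hφ.iso.map_append _ _ hv (w.drop N₁)
    rwa [List.take_append_drop] at this

theorem IsRightIdealIso.trans {φ ψ : List A ≃. List A} (hφ : IsRightIdealIso φ)
    (hψ : IsRightIdealIso ψ) : IsRightIdealIso (φ.trans ψ) := by
  refine IsRightIdealIso.of_map_append fun u w hw x => ?_
  obtain ⟨v, hv, hw⟩ := (PEquiv.mem_trans _ _ _ _).1 hw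
  exact (PEquiv.mem_trans _ _ _ _).2 ⟨v ++ x, hφ.map_append _ _ hv x, hψ.map_append _ _ hw x⟩

theorem IsFGEssentialIso.trans [Finite A] {φ ψ : List A ≃. List A} (hφ : IsFGEssentialIso φ)
    (hψ : IsFGEssentialIso ψ) : IsFGEssentialIso (φ.trans ψ) := by
  have hiso := hφ.iso.trans hψ.iso
  have hd := trans_dom_aux hφ hψ hiso
  have hi := trans_dom_aux hψ.symm hφ.symm
    (by rw [← PEquiv.symm_trans_rev]; exact hiso.symm)
  rw [← PEquiv.symm_trans_rev, pdom_symm] at hi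
  exact ⟨hiso, hd.1, hi.1, hd.2, hi.2⟩

theorem isFGEssentialIso_refl : IsFGEssentialIso (PEquiv.refl (List A)) := by
  have hd : pdom (PEquiv.refl (List A)) = Set.univ :=
    Set.eq_univ_of_forall fun u => ⟨u, rfl⟩
  have hi : pim (PEquiv.refl (List A)) = Set.univ :=
    Set.eq_univ_of_forall fun u => ⟨u, rfl⟩
  have he : IsEssentialRightIdeal (Set.univ : Set (List A)) :=
    ⟨fun _ _ _ => trivial, fun J _ hne => by simpa using hne⟩
  have hfg : IsFGRightIdeal (Set.univ : Set (List A)) :=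
    ⟨{[]}, Set.finite_singleton _, by ext; simp⟩
  refine ⟨IsRightIdealIso.of_map_append ?_, ?_, ?_, ?_, ?_⟩
  · intro u v hv x
    have : u = v := Option.some.inj hv
    subst this
    rfl
  all_goals simpa only [hd, hi]

theorem isMaximalIso_refl : IsMaximalIso (PEquiv.refl (List A)) := by
  intro ψ _ hle
  ext1 u
  exact hle u u rfl

theorem IsMaxExtension.isMaximalIso {φ ψ : List A ≃. List A} (h : IsMaxExtension φ ψ) :
    IsMaximalIso ψ :=
  fun _ hχ hle => le_antisymm (h.2 ⟨hχ, h.1.2.trans hle⟩) hle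

theorem maxExt_of_isMaximalIso {φ : List A ≃. List A} (hφ : IsFGEssentialIso φ)
    (hm : IsMaximalIso φ) : maxExt φ = φ :=
  hm _ (isMaxExtension_maxExt hφ).1.1 (isMaxExtension_maxExt hφ).1.2

/-- If `β` extends `α` then `max α = max β`. -/
theorem maxExt_eq_of_le {α β : List A ≃. List A} (hα : IsFGEssentialIso α)
    (hβ : IsFGEssentialIso β) (hle : α ≤ β) : maxExt α = maxExt β := by
  have h₁ := isMaxExtension_maxExt hα
  have h₂ := isMaxExtension_maxExt hβ
  exact (h₂.isMaximalIso _ h₁.1.1 (h₁.2 ⟨h₂.1.1, hle.trans h₂.1.2⟩))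

theorem PEquiv.trans_le_trans_of_le {α α' β β' : List A ≃. List A} (h : α ≤ α') (h' : β ≤ β') :
    α.trans β ≤ α'.trans β' := by
  intro u w hw
  obtain ⟨v, hv, hw⟩ := (PEquiv.mem_trans _ _ _ _).1 hw
  exact (PEquiv.mem_trans _ _ _ _).2 ⟨v, h _ _ hv, h' _ _ hw⟩

/-- The Thompson-Higman group over the alphabet `A`, as a set: all maximal isomorphisms between
finitely generated essential right ideals of `A^*`. -/
def ThompsonHigmanOver (A : Type*) : Type _ :=
  {φ : List A ≃. List A // IsFGEssentialIso φ ∧ IsMaximalIso φ}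

/-- Product `φ · ψ = max (φ ∘ ψ)` (with `ψ` applied first). -/
noncomputable instance [Finite A] : Mul (ThompsonHigmanOver A) where
  mul φ ψ := ⟨maxExt (ψ.1.trans φ.1),
    (ψ.2.1.trans φ.2.1).of_le (isMaxExtension_maxExt (ψ.2.1.trans φ.2.1)).1.1
      (isMaxExtension_maxExt (ψ.2.1.trans φ.2.1)).1.2,
    (isMaxExtension_maxExt (ψ.2.1.trans φ.2.1)).isMaximalIso⟩

instance : One (ThompsonHigmanOver A) where
  one := ⟨PEquiv.refl _, isFGEssentialIso_refl, isMaximalIso_refl⟩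

instance : Inv (ThompsonHigmanOver A) where
  inv φ := ⟨φ.1.symm, φ.2.1.symm, φ.2.2.symm⟩

theorem ThompsonHigmanOver.mul_val [Finite A] (φ ψ : ThompsonHigmanOver A) :
    (φ * ψ).1 = maxExt (ψ.1.trans φ.1) := rfl

theorem ThompsonHigmanOver.one_val : (1 : ThompsonHigmanOver A).1 = PEquiv.refl _ := rfl

theorem ThompsonHigmanOver.inv_val (φ : ThompsonHigmanOver A) : (φ⁻¹).1 = φ.1.symm := rfl

noncomputable instance [Finite A] : Group (ThompsonHigmanOver A) :=
  Group.ofLeftAxioms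
    (by
      intro α β γ
      apply Subtype.ext
      simp only [ThompsonHigmanOver.mul_val]
      have h₁ := β.2.1.trans α.2.1
      have h₂ := γ.2.1.trans β.2.1
      have e₁ := isMaxExtension_maxExt h₁
      have e₂ := isMaxExtension_maxExt h₂
      rw [← maxExt_eq_of_le (γ.2.1.trans h₁) (γ.2.1.trans (h₁.of_le e₁.1.1 e₁.1.2))
          (PEquiv.trans_le_trans_of_le le_rfl e₁.1.2),
        ← maxExt_eq_of_le (h₂.trans α.2.1) ((h₂.of_le e₂.1.1 e₂.1.2).trans α.2.1)
          (PEquiv.trans_le_trans_of_le e₂.1.2 le_rfl), PEquiv.trans_assoc])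
    (by
      intro α
      apply Subtype.ext
      rw [ThompsonHigmanOver.mul_val, ThompsonHigmanOver.one_val, PEquiv.trans_refl,
        maxExt_of_isMaximalIso α.2.1 α.2.2])
    (by
      intro α
      apply Subtype.ext
      rw [ThompsonHigmanOver.mul_val, ThompsonHigmanOver.inv_val, ThompsonHigmanOver.one_val,
        maxExt_eq_of_le (α.2.1.trans α.2.1.symm) isFGEssentialIso_refl
          (by
            intro u w hw
            obtain ⟨v, hv, hw⟩ := (PEquiv.mem_trans _ _ _ _).1 hw
            rw [PEquiv.mem_iff_mem] at hw
            rw [PEquiv.inj _ hv hw]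
            rfl),
        maxExt_of_isMaximalIso isFGEssentialIso_refl isMaximalIso_refl])

/-- The Thompson-Higman group `G_{n,1}`: the alphabet has `n` letters. -/
abbrev ThompsonHigman (n : ℕ) : Type := ThompsonHigmanOver (Fin n)

/-- The Thompson group `V`: the alphabet `{a, b}` has two letters. -/
abbrev ThompsonV : Type := ThompsonHigman 2

end ThompsonHigman

/-! ## The Cuntz algebra `O_n` -/

section Cuntz

/-- The Cuntz relations for `s_1, …, s_n` in a unital `*`-algebra:
`s_i^* s_i = 1`, `s_i^* s_j = 0` for `i ≠ j`, and `∑ i, s_i s_i^* = 1`. -/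
structure IsCuntzFamily {n : ℕ} {B : Type*} [Ring B] [StarRing B] (s : Fin n → B) : Prop where
  star_mul_self : ∀ i, star (s i) * s i = 1
  star_mul_of_ne : ∀ i j, i ≠ j → star (s i) * s j = 0
  sum_mul_star : ∑ i, s i * star (s i) = 1

/-- A representation of the Cuntz relations in some nonzero unital C*-algebra. -/
structure CuntzRep (n : ℕ) where
  /-- the C*-algebra -/
  carrier : Type
  [cstar : CStarAlgebra carrier]
  [nontrivial : Nontrivial carrier]
  /-- the generators -/
  gen : Fin n → carrier
  isCuntz : IsCuntzFamily gen

attribute [instance] CuntzRep.cstar CuntzRep.nontrivial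

/-- The C*-algebra of bounded families indexed by all representations of the Cuntz relations. -/
def CuntzProduct (n : ℕ) : Type 1 := lp (fun ρ : CuntzRep n => ρ.carrier) ∞

/-- Bounded families in unital C*-algebras form a unital C*-algebra, with pointwise operations
and the supremum norm. -/
noncomputable def lpCStarAlgebra {I : Type*} (B : I → Type*) [∀ i, CStarAlgebra (B i)]
    [∀ i, Nontrivial (B i)] : CStarAlgebra (lp B ∞) where

noncomputable instance (n : ℕ) : CStarAlgebra (CuntzProduct n) :=
  lpCStarAlgebra fun ρ : CuntzRep n => ρ.carrier

theorem norm_le_one_of_star_mul_self {B : Type*} [CStarAlgebra B] [Nontrivial B] {x : B}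
    (h : star x * x = 1) : ‖x‖ ≤ 1 := by
  have h' := CStarRing.norm_star_mul_self (x := x)
  rw [h, norm_one] at h'
  nlinarith [norm_nonneg x]

/-- Evaluation of a bounded family in one of the representations. -/
noncomputable def CuntzProduct.eval {n : ℕ} (ρ : CuntzRep n) :
    CuntzProduct n →⋆ₐ[ℂ] ρ.carrier where
  toFun x := (show lp (fun ρ : CuntzRep n => ρ.carrier) ∞ from x) ρ
  map_one' := rfl
  map_mul' _ _ := rfl
  map_zero' := rfl
  map_add' _ _ := rfl
  commutes' _ := rfl
  map_star' _ := rfl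

theorem CuntzProduct.ext {n : ℕ} {x y : CuntzProduct n}
    (h : ∀ ρ, CuntzProduct.eval ρ x = CuntzProduct.eval ρ y) : x = y :=
  lp.ext (funext h)

/-- The universal generators: in each representation, the generators of that representation. -/
noncomputable def cuntzProductGen (n : ℕ) (i : Fin n) : CuntzProduct n :=
  ⟨fun ρ => ρ.gen i, memℓp_infty ⟨1, by
    rintro _ ⟨ρ, rfl⟩
    exact norm_le_one_of_star_mul_self (ρ.isCuntz.star_mul_self i)⟩⟩

/-- The Cuntz algebra `O_n`, the universal unital C*-algebra on generators `s_1, …, s_n` subject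
to the Cuntz relations: the completion (here, closure) of the `*`-algebra generated by
`s_1, …, s_n` in the C*-norm `‖x‖ = sup_ρ ‖ρ(x)‖`, over all representations `ρ` of the Cuntz
relations in unital C*-algebras. (A C*-algebra generated by finitely many elements is separable,
so restricting to C*-algebras in `Type` loses no representation.) -/
noncomputable def cuntzSubalgebra (n : ℕ) : StarSubalgebra ℂ (CuntzProduct n) :=
  (StarAlgebra.adjoin ℂ (Set.range (cuntzProductGen n))).topologicalClosure

/-- The Cuntz algebra `O_n` as a type. -/
def CuntzAlgebra (n : ℕ) : Type 1 := cuntzSubalgebra n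

/-- `O_n` is a C*-algebra, as a closed `*`-subalgebra of a C*-algebra. -/
noncomputable def cuntzCStarAlgebra (n : ℕ) : CStarAlgebra (CuntzAlgebra n) :=
  StarSubalgebra.cstarAlgebra (cuntzSubalgebra n)
    (h_closed := StarSubalgebra.isClosed_topologicalClosure _)

noncomputable instance (n : ℕ) : CStarAlgebra (CuntzAlgebra n) := cuntzCStarAlgebra n

/-- The generators of `O_n`. -/
noncomputable def cuntzGen (n : ℕ) (i : Fin n) : CuntzAlgebra n :=
  ⟨cuntzProductGen n i, StarSubalgebra.le_topologicalClosure _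
    (StarAlgebra.subset_adjoin ℂ _ ⟨i, rfl⟩)⟩

/-- The inclusion of `O_n` into the product. -/
noncomputable def CuntzAlgebra.toProduct (n : ℕ) : CuntzAlgebra n →⋆ₐ[ℂ] CuntzProduct n :=
  (cuntzSubalgebra n).subtype

theorem CuntzAlgebra.toProduct_injective (n : ℕ) :
    Function.Injective (CuntzAlgebra.toProduct n) := Subtype.val_injective

/-- Evaluation of elements of `O_n` in a representation of the Cuntz relations. -/
noncomputable def CuntzAlgebra.eval {n : ℕ} (ρ : CuntzRep n) : CuntzAlgebra n →⋆ₐ[ℂ] ρ.carrier :=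
  (CuntzProduct.eval ρ).comp (CuntzAlgebra.toProduct n)

theorem CuntzAlgebra.eval_gen {n : ℕ} (ρ : CuntzRep n) (i : Fin n) :
    CuntzAlgebra.eval ρ (cuntzGen n i) = ρ.gen i := rfl

theorem CuntzAlgebra.ext {n : ℕ} {x y : CuntzAlgebra n}
    (h : ∀ ρ, CuntzAlgebra.eval ρ x = CuntzAlgebra.eval ρ y) : x = y :=
  CuntzAlgebra.toProduct_injective n (CuntzProduct.ext h)

/-- The generators of `O_n` satisfy the Cuntz relations. -/
theorem isCuntzFamily_cuntzGen (n : ℕ) : IsCuntzFamily (cuntzGen n) where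
  star_mul_self i := CuntzAlgebra.ext fun ρ => by
    simpa [map_star, CuntzAlgebra.eval_gen] using ρ.isCuntz.star_mul_self i
  star_mul_of_ne i j hij := CuntzAlgebra.ext fun ρ => by
    simpa [map_star, CuntzAlgebra.eval_gen] using ρ.isCuntz.star_mul_of_ne i j hij
  sum_mul_star := CuntzAlgebra.ext fun ρ => by
    simpa [map_star, CuntzAlgebra.eval_gen] using ρ.isCuntz.sum_mul_star

/-- The universal property of `O_n`. -/
theorem existsUnique_starAlgHom_of_isCuntzFamily {n : ℕ} {B : Type} [CStarAlgebra B]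
    (t : Fin n → B) (ht : IsCuntzFamily t) :
    ∃! π : CuntzAlgebra n →⋆ₐ[ℂ] B, ∀ i, π (cuntzGen n i) = t i := by
  refine existsUnique_of_exists_of_unique ?_ ?_
  · rcases subsingleton_or_nontrivial B with h | h
    · exact ⟨{ toFun := fun _ => 0
               map_one' := Subsingleton.elim _ _
               map_mul' := fun _ _ => Subsingleton.elim _ _
               map_zero' := rfl
               map_add' := fun _ _ => Subsingleton.elim _ _
               commutes' := fun _ => Subsingleton.elim _ _
               map_star' := fun _ => Subsingleton.elim _ _ }, fun _ => Subsingleton.elim _ _⟩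
    · exact ⟨CuntzAlgebra.eval ⟨B, t, ht⟩, fun _ => rfl⟩
  · intro π₁ π₂ h₁ h₂
    have c₁ : Continuous π₁ := map_continuous π₁
    have c₂ : Continuous π₂ := map_continuous π₂
    refine StarAlgHom.ext_topologicalClosure (S := StarAlgebra.adjoin ℂ _) c₁ c₂ ?_
    refine StarAlgHom.ext_adjoin ?_
    rintro ⟨_, _⟩ ⟨i, rfl⟩
    exact (h₁ i).trans (h₂ i).symm

end Cuntz

/-!
Write `s_w = s_{i₁} ⋯ s_{iₖ}` for the word `w = i₁ ⋯ iₖ`. For each `N`, the words of length `N`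
again form a Cuntz family, so an element `x` is determined by the products `x s_w` with `|w| = N`,
and these products may be prescribed. If `φ` is an isomorphism between finitely generated essential
right ideals, its domain contains all words of some length `N`, and there is exactly one element
`T_φ = ∑_{|w| = N} s_{φ(w)} s_w^*` with `T_φ s_u = s_{φ(u)}` for all `u` in the domain of `φ`.

Uniqueness makes `T` insensitive to extension of `φ`, hence multiplicative on maximal isomorphisms.
A right-ideal isomorphism preserves prefixes, and `s_u^* s_v` depends only on how `u` and `v`
compare as prefixes; therefore `T_φ^*` acts as `φ⁻¹`, and `T_φ` is unitary. If `n ≥ 2` and `1 ≠ 0`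
then distinct words have distinct products, so `T_φ = 1` forces `φ` to be the identity on its
domain. Finally `O_n ≠ 0` because the Cuntz relations hold for isometries of `ℓ²` with orthogonal
ranges that span the whole space.
-/

theorem IsRightIdealIso.prefix_iff {A : Type*} {φ : List A ≃. List A} (hφ : IsRightIdealIso φ)
    {u u' v v' : List A} (hv : v ∈ φ u) (hv' : v' ∈ φ u') : v <+: v' ↔ u <+: u' := by
  constructor
  · rintro ⟨t, rfl⟩
    exact ⟨t, φ.inj (hφ.map_append u v hv t) hv'⟩
  · rintro ⟨t, rfl⟩
    exact ⟨t, Option.mem_unique (hφ.map_append u v hv t) hv'⟩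

section WordProd

variable {A M : Type*} [Monoid M] {s : A → M}

/-- The product `s_w = s_{i₁} ⋯ s_{iₖ}` attached to the word `w = i₁ ⋯ iₖ`. -/
def wordProd (s : A → M) (w : List A) : M := (w.map s).prod

@[simp] theorem wordProd_nil : wordProd s [] = 1 := rfl

@[simp] theorem wordProd_cons (i : A) (w : List A) :
    wordProd s (i :: w) = s i * wordProd s w := by
  rw [wordProd, List.map_cons, List.prod_cons, wordProd]

theorem wordProd_append (u v : List A) :
    wordProd s (u ++ v) = wordProd s u * wordProd s v := by
  simp only [wordProd, List.map_append, List.prod_append]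

/-- The element `x` implements the partial bijection `φ` of words if left multiplication by `x`
takes `s_u` to `s_{φ(u)}` for every `u` in the domain of `φ`. -/
def Implements (s : A → M) (φ : List A ≃. List A) (x : M) : Prop :=
  ∀ u v : List A, v ∈ φ u → x * wordProd s u = wordProd s v

namespace Implements

variable {φ ψ : List A ≃. List A} {x y : M}

theorem one : Implements s (PEquiv.refl (List A)) 1 := by
  intro u v hv
  rw [one_mul, Option.some.inj hv]

theorem trans (hx : Implements s φ x) (hy : Implements s ψ y) :
    Implements s (φ.trans ψ) (y * x) := by
  intro u w hw
  obtain ⟨v, hv, hw⟩ := (PEquiv.mem_trans _ _ _ _).1 hw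
  rw [mul_assoc, hx u v hv, hy v w hw]

theorem mono (hx : Implements s ψ x) (h : φ ≤ ψ) : Implements s φ x :=
  fun u v hv => hx u v (h u v hv)

theorem le_refl_of_one (hs : Function.Injective (wordProd s)) (h : Implements s φ 1) :
    φ ≤ PEquiv.refl (List A) := by
  intro u v hv
  have huv : u = v := hs (by simpa only [one_mul] using h u v hv)
  exact congrArg some huv

end Implements

end WordProd

theorem sum_mul_star_mul_of_orthonormal {ι B : Type*} [Fintype ι] [Semiring B] [Star B] {s : ι → B}
    (h₁ : ∀ i, star (s i) * s i = 1) (h₂ : ∀ i j, i ≠ j → star (s i) * s j = 0) (y : ι → B)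
    (i : ι) : (∑ j, y j * star (s j)) * s i = y i := by
  rw [Finset.sum_mul, Finset.sum_eq_single i]
  · rw [mul_assoc, h₁, mul_one]
  · intro j _ hj
    rw [mul_assoc, h₂ j i hj, mul_zero]
  · exact fun hi => absurd (Finset.mem_univ i) hi

section CuntzFamily

variable {n : ℕ} {B : Type*} [Ring B] [StarRing B] {s : Fin n → B}

namespace IsCuntzFamily

theorem eq_of_mul_eq (hs : IsCuntzFamily s) {x y : B} (h : ∀ i, x * s i = y * s i) : x = y :=
  calc x = ∑ i, x * s i * star (s i) := by
        simp only [mul_assoc, ← Finset.mul_sum, hs.sum_mul_star, mul_one]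
    _ = ∑ i, y * s i * star (s i) := by simp only [h]
    _ = y := by simp only [mul_assoc, ← Finset.mul_sum, hs.sum_mul_star, mul_one]

theorem eq_of_mul_wordProd_eq (hs : IsCuntzFamily s) {x y : B} (N : ℕ)
    (h : ∀ w : List (Fin n), w.length = N → x * wordProd s w = y * wordProd s w) : x = y := by
  induction N generalizing x y with
  | zero => simpa using h [] rfl
  | succ N ih =>
    refine hs.eq_of_mul_eq fun i => ih fun w hw => ?_
    simpa only [wordProd_cons, mul_assoc] using h (i :: w) (congrArg Nat.succ hw)

theorem eq_of_star_wordProd_mul_eq (hs : IsCuntzFamily s) {x y : B} (N : ℕ)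
    (h : ∀ w : List (Fin n), w.length = N →
      star (wordProd s w) * x = star (wordProd s w) * y) : x = y := by
  refine star_injective (hs.eq_of_mul_wordProd_eq N fun w hw => star_injective ?_)
  simpa only [star_mul, star_star] using h w hw

theorem exists_mul_wordProd_eq (hs : IsCuntzFamily s) (N : ℕ) (g : List (Fin n) → B) :
    ∃ x : B, ∀ w : List (Fin n), w.length = N → x * wordProd s w = g w := by
  induction N generalizing g with
  | zero =>
    refine ⟨g [], fun w hw => ?_⟩
    rw [List.length_eq_zero_iff.1 hw, wordProd_nil, mul_one]
  | succ N ih =>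
    choose y hy using fun i => ih fun w => g (i :: w)
    refine ⟨∑ i, y i * star (s i), fun w hw => ?_⟩
    obtain ⟨i, w, rfl⟩ := List.exists_cons_of_length_eq_add_one hw
    rw [wordProd_cons, ← mul_assoc,
      sum_mul_star_mul_of_orthonormal hs.star_mul_self hs.star_mul_of_ne,
      hy i w (Nat.succ.inj hw)]

theorem star_wordProd_mul_self (hs : IsCuntzFamily s) (w : List (Fin n)) :
    star (wordProd s w) * wordProd s w = 1 := by
  induction w with
  | nil => rw [wordProd_nil, star_one, one_mul]
  | cons i w ih =>
    rw [wordProd_cons, star_mul, mul_assoc, ← mul_assoc (star (s i)), hs.star_mul_self, one_mul, ih]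

theorem star_wordProd_mul_wordProd_append (hs : IsCuntzFamily s) (u t : List (Fin n)) :
    star (wordProd s u) * wordProd s (u ++ t) = wordProd s t := by
  rw [wordProd_append, ← mul_assoc, hs.star_wordProd_mul_self, one_mul]

theorem star_wordProd_append_mul_wordProd (hs : IsCuntzFamily s) (u t : List (Fin n)) :
    star (wordProd s (u ++ t)) * wordProd s u = star (wordProd s t) := by
  rw [← hs.star_wordProd_mul_wordProd_append u t, star_mul, star_star]

theorem star_wordProd_mul_wordProd_eq_zero (hs : IsCuntzFamily s) {u v : List (Fin n)}
    (huv : ¬ u <+: v) (hvu : ¬ v <+: u) : star (wordProd s u) * wordProd s v = 0 := by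
  induction u generalizing v with
  | nil => exact absurd v.nil_prefix huv
  | cons i u ih =>
    cases v with
    | nil => exact absurd (i :: u).nil_prefix hvu
    | cons j v =>
      rw [wordProd_cons, wordProd_cons, star_mul, mul_assoc, ← mul_assoc (star (s i))]
      obtain rfl | hij := eq_or_ne i j
      · rw [hs.star_mul_self, one_mul]
        exact ih (fun h => huv (List.cons_prefix_cons.2 ⟨rfl, h⟩))
          fun h => hvu (List.cons_prefix_cons.2 ⟨rfl, h⟩)
      · rw [hs.star_mul_of_ne i j hij, zero_mul, mul_zero]

theorem star_wordProd_mul_wordProd_congr (hs : IsCuntzFamily s)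
    {φ : List (Fin n) ≃. List (Fin n)} (hφ : IsRightIdealIso φ) {u u' v v' : List (Fin n)}
    (hv : v ∈ φ u) (hv' : v' ∈ φ u') :
    star (wordProd s v) * wordProd s v' = star (wordProd s u) * wordProd s u' := by
  by_cases h : u <+: u'
  · obtain ⟨t, rfl⟩ := h
    rw [Option.mem_unique hv' (hφ.map_append u v hv t), hs.star_wordProd_mul_wordProd_append,
      hs.star_wordProd_mul_wordProd_append]
  by_cases h' : u' <+: u
  · obtain ⟨t, rfl⟩ := h'
    rw [Option.mem_unique hv (hφ.map_append u' v' hv' t), hs.star_wordProd_append_mul_wordProd,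
      hs.star_wordProd_append_mul_wordProd]
  · rw [hs.star_wordProd_mul_wordProd_eq_zero h h',
      hs.star_wordProd_mul_wordProd_eq_zero (mt (hφ.prefix_iff hv hv').1 h)
        (mt (hφ.prefix_iff hv' hv).1 h')]

theorem eq_nil_of_wordProd_eq_one [Nontrivial B] (hs : IsCuntzFamily s) (hn : 2 ≤ n)
    {w : List (Fin n)} (h : wordProd s w = 1) : w = [] := by
  cases w with
  | nil => rfl
  | cons i w =>
    have : Nontrivial (Fin n) := Fin.nontrivial_iff_two_le.2 hn
    obtain ⟨j, hji⟩ := exists_ne i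
    have star_eq_zero : star (s j) = 0 := by
      rw [← mul_one (star (s j)), ← h, wordProd_cons, ← mul_assoc, hs.star_mul_of_ne j i hji,
        zero_mul]
    have one_eq_zero : (1 : B) = 0 := by rw [← hs.star_mul_self j, star_eq_zero, zero_mul]
    exact absurd one_eq_zero one_ne_zero

theorem wordProd_injective [Nontrivial B] (hs : IsCuntzFamily s) (hn : 2 ≤ n) :
    Function.Injective (wordProd s) := by
  intro u v huv
  have star_mul_eq_one : star (wordProd s u) * wordProd s v = 1 := by
    rw [← huv, hs.star_wordProd_mul_self]
  have comparable : u <+: v ∨ v <+: u := by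
    by_contra! h
    exact zero_ne_one ((hs.star_wordProd_mul_wordProd_eq_zero h.1 h.2).symm.trans star_mul_eq_one)
  obtain ⟨t, rfl⟩ | ⟨t, rfl⟩ := comparable
  · rw [hs.star_wordProd_mul_wordProd_append] at star_mul_eq_one
    rw [hs.eq_nil_of_wordProd_eq_one hn star_mul_eq_one, List.append_nil]
  · rw [hs.star_wordProd_append_mul_wordProd] at star_mul_eq_one
    have wordProd_eq_one : wordProd s t = 1 :=
      star_injective (star_mul_eq_one.trans (star_one B).symm)
    rw [hs.eq_nil_of_wordProd_eq_one hn wordProd_eq_one, List.append_nil]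

section Implementation

variable {φ : List (Fin n) ≃. List (Fin n)}

theorem implements_of_length_eq (hs : IsCuntzFamily s) (hφ : IsRightIdealIso φ) {N : ℕ}
    (hN : ∀ w : List (Fin n), N ≤ w.length → w ∈ pdom φ) {x : B}
    (hx : ∀ w v : List (Fin n), w.length = N → v ∈ φ w → x * wordProd s w = wordProd s v) :
    Implements s φ x := by
  have mul_of_le (u v : List (Fin n)) (hu : N ≤ u.length) (hv : v ∈ φ u) :
      x * wordProd s u = wordProd s v := by
    have length_take : (u.take N).length = N := List.length_take_of_le hu
    obtain ⟨v', hv'⟩ := hN (u.take N) length_take.ge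
    have hv'_append := hφ.map_append _ _ hv' (u.drop N)
    rw [List.take_append_drop] at hv'_append
    calc x * wordProd s u
        = x * wordProd s (u.take N) * wordProd s (u.drop N) := by
          rw [mul_assoc, ← wordProd_append, List.take_append_drop]
      _ = wordProd s (v' ++ u.drop N) := by rw [hx _ _ length_take hv', wordProd_append]
      _ = wordProd s v := by rw [Option.mem_unique hv'_append hv]
  intro u v hv
  refine hs.eq_of_mul_wordProd_eq N fun t ht => ?_
  rw [mul_assoc, ← wordProd_append, ← wordProd_append]
  exact mul_of_le _ _ (by rw [List.length_append]; omega) (hφ.map_append u v hv t)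

theorem exists_implements (hs : IsCuntzFamily s) (hφ : IsRightIdealIso φ)
    (hd : IsEssentialRightIdeal (pdom φ)) (hfg : IsFGRightIdeal (pdom φ)) :
    ∃ x : B, Implements s φ x := by
  obtain ⟨N, hN⟩ := exists_length_bound hd hfg
  obtain ⟨x, hx⟩ := hs.exists_mul_wordProd_eq N fun w => wordProd s ((φ w).getD [])
  refine ⟨x, hs.implements_of_length_eq hφ hN fun w v hw hv => ?_⟩
  rw [hx w hw, Option.mem_def.1 hv, Option.getD_some]

theorem implements_unique (hs : IsCuntzFamily s) (hd : IsEssentialRightIdeal (pdom φ))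
    (hfg : IsFGRightIdeal (pdom φ)) {x y : B} (hx : Implements s φ x) (hy : Implements s φ y) :
    x = y := by
  obtain ⟨N, hN⟩ := exists_length_bound hd hfg
  refine hs.eq_of_mul_wordProd_eq N fun w hw => ?_
  obtain ⟨v, hv⟩ := hN w hw.ge
  rw [hx w v hv, hy w v hv]

theorem implements_star (hs : IsCuntzFamily s) (hφ : IsRightIdealIso φ)
    (hd : IsEssentialRightIdeal (pdom φ)) (hfg : IsFGRightIdeal (pdom φ)) {x : B}
    (hx : Implements s φ x) : Implements s φ.symm (star x) := by
  obtain ⟨N, hN⟩ := exists_length_bound hd hfg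
  intro v u hu
  have hv : v ∈ φ u := (PEquiv.mem_iff_mem φ).1 hu
  refine hs.eq_of_star_wordProd_mul_eq N fun w hw => ?_
  obtain ⟨w', hw'⟩ := hN w hw.ge
  calc star (wordProd s w) * (star x * wordProd s v)
      = star (x * wordProd s w) * wordProd s v := by rw [star_mul, mul_assoc]
    _ = star (wordProd s w') * wordProd s v := by rw [hx w w' hw']
    _ = star (wordProd s w) * wordProd s u := hs.star_wordProd_mul_wordProd_congr hφ hw' hv

end Implementation

/-- The element `T_φ = ∑_{|w| = N} s_{φ(w)} s_w^*` (for any large `N`) attached to an element `φ`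
of the Thompson-Higman group, encoded as the unique element that implements `φ`. -/
noncomputable def thompsonElement (hs : IsCuntzFamily s) (φ : ThompsonHigman n) : B :=
  (hs.exists_implements φ.2.1.iso φ.2.1.essential_dom φ.2.1.fg_dom).choose

theorem implements_thompsonElement (hs : IsCuntzFamily s) (φ : ThompsonHigman n) :
    Implements s φ.1 (hs.thompsonElement φ) :=
  (hs.exists_implements φ.2.1.iso φ.2.1.essential_dom φ.2.1.fg_dom).choose_spec

theorem thompsonElement_eq_of_implements (hs : IsCuntzFamily s) {φ : ThompsonHigman n} {x : B}
    {ψ : List (Fin n) ≃. List (Fin n)} (hψ : IsFGEssentialIso ψ) (hle : ψ ≤ φ.1)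
    (hx : Implements s ψ x) : hs.thompsonElement φ = x :=
  hs.implements_unique hψ.essential_dom hψ.fg_dom ((hs.implements_thompsonElement φ).mono hle) hx

theorem thompsonElement_one (hs : IsCuntzFamily s) :
    hs.thompsonElement (1 : ThompsonHigman n) = 1 :=
  hs.thompsonElement_eq_of_implements isFGEssentialIso_refl le_rfl Implements.one

theorem thompsonElement_mul (hs : IsCuntzFamily s) (φ ψ : ThompsonHigman n) :
    hs.thompsonElement (φ * ψ) = hs.thompsonElement φ * hs.thompsonElement ψ := by
  have hfg := ψ.2.1.trans φ.2.1
  exact hs.thompsonElement_eq_of_implements hfg (isMaxExtension_maxExt hfg).1.2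
    ((hs.implements_thompsonElement ψ).trans (hs.implements_thompsonElement φ))

theorem thompsonElement_inv (hs : IsCuntzFamily s) (φ : ThompsonHigman n) :
    hs.thompsonElement φ⁻¹ = star (hs.thompsonElement φ) :=
  hs.thompsonElement_eq_of_implements φ.2.1.symm le_rfl
    (hs.implements_star φ.2.1.iso φ.2.1.essential_dom φ.2.1.fg_dom
      (hs.implements_thompsonElement φ))

theorem thompsonElement_mem_unitary (hs : IsCuntzFamily s) (φ : ThompsonHigman n) :
    hs.thompsonElement φ ∈ unitary B := by
  rw [Unitary.mem_iff, ← hs.thompsonElement_inv, ← hs.thompsonElement_mul,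
    ← hs.thompsonElement_mul, inv_mul_cancel, mul_inv_cancel, hs.thompsonElement_one]
  exact ⟨rfl, rfl⟩

theorem eq_one_of_thompsonElement_eq_one [Nontrivial B] (hs : IsCuntzFamily s) (hn : 2 ≤ n)
    {φ : ThompsonHigman n} (h : hs.thompsonElement φ = 1) : φ = 1 := by
  have implements_one : Implements s φ.1 1 := h ▸ hs.implements_thompsonElement φ
  have le_refl := implements_one.le_refl_of_one (hs.wordProd_injective hn)
  exact Subtype.ext (φ.2.2 _ isFGEssentialIso_refl.iso le_refl).symm

/-- The unitary representation `φ ↦ T_φ` of the Thompson-Higman group. -/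
noncomputable def thompsonUnitary (hs : IsCuntzFamily s) : ThompsonHigman n →* unitary B where
  toFun φ := ⟨hs.thompsonElement φ, hs.thompsonElement_mem_unitary φ⟩
  map_one' := Subtype.ext hs.thompsonElement_one
  map_mul' φ ψ := Subtype.ext (hs.thompsonElement_mul φ ψ)

end IsCuntzFamily

end CuntzFamily

section HilbertSpace

open ContinuousLinearMap

variable {𝕜 ι H : Type*} [RCLike 𝕜] [NormedAddCommGroup H] [InnerProductSpace 𝕜 H]

theorem clm_ext_of_hilbertBasis {E : Type*} [AddCommMonoid E] [Module 𝕜 E] [TopologicalSpace E]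
    [T2Space E] (b : HilbertBasis ι 𝕜 H) {S T : H →L[𝕜] E} (h : ∀ i, S (b i) = T (b i)) : S = T :=
  ContinuousLinearMap.ext_on (Submodule.dense_iff_topologicalClosure_eq_top.2 b.dense_span)
    (Set.forall_mem_range.2 h)

theorem eq_of_inner_hilbertBasis_eq (b : HilbertBasis ι 𝕜 H) {x y : H}
    (h : ∀ i, inner 𝕜 (b i) x = inner 𝕜 (b i) y) : x = y :=
  b.repr.injective (lp.ext (funext fun i => by rw [b.repr_apply_apply, b.repr_apply_apply, h i]))

/-- The isometry that maps the Hilbert basis `b` to the orthonormal family `v`. -/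
noncomputable def isometryOfOrthonormal {E : Type*} [NormedAddCommGroup E] [InnerProductSpace 𝕜 E]
    [CompleteSpace E] (b : HilbertBasis ι 𝕜 H) {v : ι → E} (hv : Orthonormal 𝕜 v) : H →ₗᵢ[𝕜] E :=
  hv.orthogonalFamily.linearIsometry.comp b.repr.toLinearIsometry

theorem isometryOfOrthonormal_apply {E : Type*} [NormedAddCommGroup E] [InnerProductSpace 𝕜 E]
    [CompleteSpace E] (b : HilbertBasis ι 𝕜 H) {v : ι → E} (hv : Orthonormal 𝕜 v) (i : ι) :
    isometryOfOrthonormal b hv (b i) = v i := by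
  classical
  simp only [isometryOfOrthonormal, LinearIsometry.coe_comp, Function.comp_apply,
    LinearIsometryEquiv.coe_toLinearIsometry, b.repr_self,
    OrthogonalFamily.linearIsometry_apply_single, LinearIsometry.toSpanSingleton_apply, one_smul]

variable [CompleteSpace H]

theorem isCuntzFamily_of_hilbertBasis {n : ℕ} (b : HilbertBasis ι 𝕜 H)
    (c : HilbertBasis (Fin n × ι) 𝕜 H) {s : Fin n → H →L[𝕜] H}
    (hs : ∀ i x, ‖s i x‖ = ‖x‖) (hsb : ∀ i k, s i (b k) = c (i, k)) : IsCuntzFamily s := by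
  have isometry_relation : ∀ i, star (s i) * s i = 1 := fun i =>
    (norm_map_iff_adjoint_comp_self (s i)).1 (hs i)
  have orthogonality_relation : ∀ i j, i ≠ j → star (s i) * s j = 0 := by
    refine fun i j hij => clm_ext_of_hilbertBasis b fun k =>
      eq_of_inner_hilbertBasis_eq b fun l => ?_
    rw [star_eq_adjoint, mul_def, comp_apply, adjoint_inner_right, hsb, hsb, zero_apply,
      inner_zero_right]
    exact c.orthonormal.2 fun h => hij (congrArg Prod.fst h)
  refine ⟨isometry_relation, orthogonality_relation, clm_ext_of_hilbertBasis c fun ⟨i, k⟩ => ?_⟩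
  have sum_mul : (∑ j, s j * star (s j)) * s i = s i :=
    sum_mul_star_mul_of_orthonormal isometry_relation orthogonality_relation s i
  rw [← hsb]
  exact congrArg (· (b k)) sum_mul

/-- The Hilbert basis `b` with its index set relabelled along `e`. -/
noncomputable def reindexHilbertBasis {ι' : Type*} (b : HilbertBasis ι 𝕜 H) (e : ι ≃ ι') :
    HilbertBasis ι' 𝕜 H :=
  HilbertBasis.mk (b.orthonormal.comp e.symm e.symm.injective) <| by
    rw [e.symm.surjective.range_comp, b.dense_span]

end HilbertSpace

theorem nontrivial_cuntzAlgebra_of_isCuntzFamily {n : ℕ} {B : Type} [CStarAlgebra B] [Nontrivial B]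
    {t : Fin n → B} (ht : IsCuntzFamily t) : Nontrivial (CuntzAlgebra n) := by
  obtain ⟨π, -, -⟩ := existsUnique_starAlgHom_of_isCuntzFamily t ht
  exact π.toRingHom.domain_nontrivial

instance nontrivial_cuntzAlgebra (n : ℕ) [NeZero n] : Nontrivial (CuntzAlgebra n) := by
  let b : HilbertBasis ℕ ℂ (lp (fun _ : ℕ => ℂ) 2) := default
  let c : HilbertBasis (Fin n × ℕ) ℂ (lp (fun _ : ℕ => ℂ) 2) :=
    reindexHilbertBasis b ((Nat.divModEquiv n).trans (Equiv.prodComm ℕ (Fin n)))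
  have orthonormal (i : Fin n) : Orthonormal ℂ fun k => c (i, k) :=
    c.orthonormal.comp _ (Prod.mk_right_injective i)
  have cuntz : IsCuntzFamily fun i =>
      (isometryOfOrthonormal b (orthonormal i)).toContinuousLinearMap :=
    isCuntzFamily_of_hilbertBasis b c (fun i => (isometryOfOrthonormal b (orthonormal i)).norm_map)
      fun i => isometryOfOrthonormal_apply b (orthonormal i)
  have : Nontrivial (lp (fun _ : ℕ => ℂ) 2) := ⟨b 0, 0, b.orthonormal.ne_zero 0⟩
  exact nontrivial_cuntzAlgebra_of_isCuntzFamily cuntz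

theorem mainTheorem4_general {n : ℕ} (hn : 2 ≤ n) {B : Type*} [Ring B] [StarRing B] [Nontrivial B]
    {s : Fin n → B} (hs : IsCuntzFamily s) :
    ∃ f : ThompsonHigman n →* unitary B, Function.Injective f := by
  refine ⟨hs.thompsonUnitary, (injective_iff_map_eq_one _).2 fun φ h => ?_⟩
  exact hs.eq_one_of_thompsonElement_eq_one hn (congrArg Subtype.val h)

theorem mainTheorem4 :
    (∃ f : ThompsonV →* (CuntzAlgebra 2)ˣ, Function.Injective f) ∧
    (∀ n : ℕ, 2 ≤ n → ∃ f : ThompsonHigman n →* (CuntzAlgebra n)ˣ, Function.Injective f) := by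
  have embeds (n : ℕ) (hn : 2 ≤ n) :
      ∃ f : ThompsonHigman n →* (CuntzAlgebra n)ˣ, Function.Injective f := by
    have : NeZero n := ⟨by omega⟩
    obtain ⟨f, hf⟩ := mainTheorem4_general hn (isCuntzFamily_cuntzGen n)
    exact ⟨Unitary.toUnits.comp f, Unitary.toUnits_injective.comp hf⟩
  exact ⟨embeds 2 le_rfl, embeds⟩
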